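/- Let $G=(X,E)$ be a finite connected simple graph and let $H=(h_{x,y})$ be a Schrödinger operator on $G$: a real symmetric $X\times X$ matrix with $h_{x,y}<0$ if $\{x,y\}\in E$, $h_{x,y}=0$ if $x\neq y$ and $\{x,y\}\notin E$, and arbitrary diagonal. A magnetic field on $G$ is a map $B$ from the set of oriented edges to $U(1)$ with $B([y,x])=B([x,y])^{-1}$; the corresponding magnetic Schrödinger operator on $\mathbb{C}^X$ is $$H_Bf(x)=h_{x,x}f(x)+\sum_{y\sim x}h_{x,y}B([x,y])f(y),$$ with eigenvalues $\lambda_1(B)\le\dots\le\lambda_{\#X}(B)$ repeated according to multiplicity. These eigenvalues are invariant under the gauge transformations $B([x,y])\mapsto B([x,y])\,g(y)/g(x)$, $g:X\to U(1)$, so that $\Lambda_n:[B]\mapsto\lambda_n(B)$ is a function on the manifold $M$ (a torus) of magnetic fields modulo gauge transformations, whose tangent space at $[B\equiv 1]$ is $\Omega^1(G)/d\mathbb{R}^X$. Here $\Omega^1(G)$ is the space of antisymmetric real functions on the oriented edges, $df([x,y])=f(y)-f(x)$, and $[\gamma]\mapsto[e^{i\gamma}]$ is the exponential chart of $M$ at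 $[B\equiv1]$. Theorem. Suppose that $\lambda_n(1)=0$ for some $1\le n\le\#X$, that $0$ is a simple (non-degenerate) eigenvalue of $H=H_1$, and that an associated non-zero real eigenfunction $\phi$ vanishes at a vertex $x_0$ and at no other vertex. Then $\Lambda_n$ is smooth at $[B\equiv1]$, $[B\equiv1]$ is a critical point of $\Lambda_n$, and the nullity (the dimension of the kernel) of the Hessian of $\Lambda_n$ at $[B\equiv 1]$, a quadratic form on $\Omega^1(G)/d\mathbb{R}^X$, is at least $|n_+-n_-|$, where $n_\pm$ is the number of vertices $x\sim x_0$ with $\pm\phi(x)>0$. -/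

import Mathlib

open scoped Matrix ContDiff

noncomputable section

namespace MagneticGraph

section Forms

variable {X : Type*} (G : SimpleGraph X)

/-- The space `Ω¹(G)` of `1`-forms: antisymmetric real functions on the oriented edges. -/
def oneForms : Submodule ℝ (G.Dart → ℝ) where
  carrier := {γ | ∀ e : G.Dart, γ e.symm = -γ e}
  add_mem' := by
    intro a b ha hb e
    simp only [Pi.add_apply, ha e, hb e]
    ring
  zero_mem' := by
    intro e
    simp
  smul_mem' := by
    intro c a ha e
    simp [ha e]

/-- The differential `d : ℝ^X → Ω¹(G)`, `df([x,y]) = f y - f x`. -/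
def d : (X → ℝ) →ₗ[ℝ] oneForms G where
  toFun f := ⟨fun e => f e.snd - f e.fst, fun e => by
    simp [SimpleGraph.Dart.symm]⟩
  map_add' f g := by
    ext e
    simp
    ring
  map_smul' c f := by
    ext e
    simp
    ring

/-- Magnetic fields on `G`: `U(1)`-valued functions `B` on the oriented edges with
`B([y,x]) = B([x,y])⁻¹`. They form a group (a torus) under pointwise multiplication. -/
def magneticFields : Subgroup (G.Dart → Circle) where
  carrier := {B | ∀ e : G.Dart, B e.symm = (B e)⁻¹}
  mul_mem' := by
    intro a b ha hb e
    simp [ha e, hb e, mul_comm]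
  one_mem' := by
    intro e
    simp
  inv_mem' := by
    intro a ha e
    simp [ha e]

/-- The pure gauge field `[x,y] ↦ g(y) / g(x)` of `g : X → U(1)`. For `g = e^{if}` this is
`e^{i df}`. -/
def pureGauge : (X → Circle) →* magneticFields G where
  toFun g := ⟨fun e => g e.snd / g e.fst, fun e => by
    simp [SimpleGraph.Dart.symm]⟩
  map_one' := by
    ext e
    simp
  map_mul' g g' := by
    ext e
    simp [mul_div_mul_comm]

/-- The manifold (a torus) of magnetic fields on `G` modulo gauge transformations. -/
abbrev Moduli : Type _ := magneticFields G ⧸ (pureGauge G).range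

/-- `Ω¹(G) / dℝ^X`, the tangent space of `Moduli G` at the class of `B ≡ 1`. -/
abbrev TangentModuli : Type _ := oneForms G ⧸ LinearMap.range (d G)

/-- The exponential `γ ↦ e^{iγ}` from `1`-forms to magnetic fields. -/
def expField (γ : oneForms G) : magneticFields G :=
  ⟨fun e => Circle.exp ((γ : G.Dart → ℝ) e), fun e => by
    change Circle.exp _ = (Circle.exp _)⁻¹
    rw [γ.2 e, Circle.exp_neg]⟩

theorem expField_add_d (γ : oneForms G) (f : X → ℝ) :
    expField G (γ + d G f) = expField G γ * pureGauge G (fun x => Circle.exp (f x)) := by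
  ext e
  simp [expField, d, pureGauge, Circle.exp_add, Circle.exp_sub]

/-- The exponential map `[γ] ↦ [e^{iγ}]` of the torus of magnetic fields modulo gauge. It is a
group homomorphism and a local diffeomorphism, so it provides a chart around `[B ≡ 1]`. -/
def expModuli (v : TangentModuli G) : Moduli G :=
  Quotient.liftOn' v (fun γ => (QuotientGroup.mk (expField G γ) : Moduli G)) (by
    intro a b hab
    rw [Submodule.quotientRel_def] at hab
    obtain ⟨f, hf⟩ := hab
    have h : a = b + d G f := by
      rw [hf]
      abel
    change (QuotientGroup.mk (expField G a) : Moduli G) = QuotientGroup.mk (expField G b)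
    rw [h, expField_add_d, eq_comm, QuotientGroup.eq]
    exact ⟨fun x => Circle.exp (f x), by group⟩)

instance isClosed_range_d [Fintype X] [DecidableRel G.Adj] :
    IsClosed (LinearMap.range (d G) : Set (oneForms G)) :=
  Submodule.closed_of_finiteDimensional _

end Forms

section Operators

variable {X : Type*} [DecidableEq X] {G : SimpleGraph X}

variable (G) in
/-- A Schrödinger operator on `G`: a real symmetric matrix whose off-diagonal entries are negative
on edges and zero off edges, with arbitrary diagonal. -/
structure SchrodingerOperator where
  /-- The matrix of the operator. -/
  mat : Matrix X X ℝ
  symm : mat.IsSymm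
  neg_of_adj : ∀ x y, G.Adj x y → mat x y < 0
  zero_of_not_adj : ∀ x y, x ≠ y → ¬ G.Adj x y → mat x y = 0

open Classical in
/-- The matrix of the magnetic Schrödinger operator
`(H_B f)(x) = h_{x,x} f(x) + ∑_{y ∼ x} h_{x,y} B([x,y]) f(y)`. -/
def magneticMatrix (H : SchrodingerOperator G) (B : magneticFields G) : Matrix X X ℂ :=
  fun x y =>
    if h : G.Adj x y then (H.mat x y : ℂ) * (((B : G.Dart → Circle) ⟨(x, y), h⟩ : Circle) : ℂ)
    else if x = y then (H.mat x x : ℂ)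
    else 0

theorem magneticMatrix_isHermitian (H : SchrodingerOperator G) (B : magneticFields G) :
    (magneticMatrix H B).IsHermitian := by
  ext x y
  rw [Matrix.conjTranspose_apply]
  unfold magneticMatrix
  by_cases h : G.Adj x y
  · have hB := B.2 ⟨(x, y), h⟩
    rw [dif_pos h, dif_pos h.symm, ← H.symm.apply x y]
    simp only [SimpleGraph.Dart.symm_mk, Prod.swap_prod_mk] at hB
    rw [hB, Circle.coe_inv_eq_conj]
    simp
  · have h' : ¬ G.Adj y x := fun k => h k.symm
    rw [dif_neg h, dif_neg h']
    by_cases hxy : x = y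
    · subst hxy
      simp
    · rw [if_neg hxy, if_neg (Ne.symm hxy)]
      simp

variable [Fintype X]

/-- The eigenvalues of `H_B` in increasing order, repeated according to multiplicity. The index is
zero-based: `eigenvalue H 0 B` is the smallest one. -/
def eigenvalue (H : SchrodingerOperator G) (n : Fin (Fintype.card X)) (B : magneticFields G) : ℝ :=
  (magneticMatrix_isHermitian H B).eigenvalues₀ n.rev

theorem magneticMatrix_mul_pureGauge (H : SchrodingerOperator G) (B : magneticFields G)
    (g : X → Circle) :
    magneticMatrix H (B * pureGauge G g) =
      Matrix.diagonal (fun x => ((g x)⁻¹ : ℂ)) * magneticMatrix H B *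
        Matrix.diagonal (fun x => (g x : ℂ)) := by
  ext x y
  rw [Matrix.mul_diagonal, Matrix.diagonal_mul]
  unfold magneticMatrix
  by_cases h : G.Adj x y
  · rw [dif_pos h, dif_pos h]
    simp [pureGauge]
    ring
  · rw [dif_neg h, dif_neg h]
    by_cases hxy : x = y
    · subst hxy
      rw [if_pos rfl]
      have := Circle.coe_ne_zero (g x)
      field_simp
    · simp [hxy]

/-- The eigenvalues of `H_B` are gauge invariant. -/
theorem eigenvalue_mul_pureGauge (H : SchrodingerOperator G) (n : Fin (Fintype.card X))
    (B : magneticFields G) (g : X → Circle) :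
    eigenvalue H n (B * pureGauge G g) = eigenvalue H n B := by
  have hc : (magneticMatrix H (B * pureGauge G g)).charpoly = (magneticMatrix H B).charpoly := by
    rw [magneticMatrix_mul_pureGauge, Matrix.charpoly_mul_comm, ← mul_assoc,
      Matrix.diagonal_mul_diagonal]
    have : (fun x => ((g x : Circle) : ℂ) * ((g x : Circle) : ℂ)⁻¹) = fun _ => 1 := by
      funext x
      exact mul_inv_cancel₀ (Circle.coe_ne_zero _)
    rw [this, Matrix.diagonal_one, one_mul]
  have h0 : (magneticMatrix_isHermitian H (B * pureGauge G g)).eigenvalues₀ =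
      (magneticMatrix_isHermitian H B).eigenvalues₀ := by
    rw [← List.ofFn_inj, ← Matrix.IsHermitian.sort_roots_charpoly_eq_eigenvalues₀,
      ← Matrix.IsHermitian.sort_roots_charpoly_eq_eigenvalues₀, hc]
  unfold eigenvalue
  rw [h0]

/-- The function `[B] ↦ λ_n(B)` on the manifold of magnetic fields modulo gauge. -/
def eigenvalueModuli (H : SchrodingerOperator G) (n : Fin (Fintype.card X)) (b : Moduli G) : ℝ :=
  Quotient.liftOn' b (eigenvalue H n) (by
    intro B B' h
    rw [QuotientGroup.leftRel_apply] at h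
    obtain ⟨g, hg⟩ := h
    have : B' = B * pureGauge G g := by
      rw [hg]
      group
    rw [this, eigenvalue_mul_pureGauge])

/-- The function `[B] ↦ λ_n(B)` read in the exponential chart `[γ] ↦ [e^{iγ}]` at `[B ≡ 1]`. -/
def eigenvalueChart (H : SchrodingerOperator G) (n : Fin (Fintype.card X))
    (v : TangentModuli G) : ℝ :=
  eigenvalueModuli H n (expModuli G v)

end Operators

section Hessian

variable {E : Type*} [NormedAddCommGroup E] [NormedSpace ℝ E]

/-- The Hessian (second derivative) of `f` at `p`, as a bilinear form. -/
def hessian (f : E → ℝ) (p : E) : E →L[ℝ] E →L[ℝ] ℝ :=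
  fderiv ℝ (fderiv ℝ f) p

/-- The nullity of `f` at `p`: the dimension of the kernel
`{u | ∀ v, Hess f (u, v) = 0}` of its Hessian. -/
def nullity (f : E → ℝ) (p : E) : ℕ :=
  Module.finrank ℝ (LinearMap.ker (hessian f p : E →ₗ[ℝ] (E →L[ℝ] ℝ)))

end Hessian

end MagneticGraph

end

/-! Pull `Λ_n` back to `Ω¹(G)`, with `A γ` the matrix of `e^{iγ}` and `λ` its eigenvalue. The
implicit function theorem gives a smooth eigenpair `(w, t)` through `(φ, 0)` with `⟨φ, w⟩ = ⟨φ, φ⟩`.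
Weyl's inequality makes the ordered eigenvalues continuous, which forces `t = λ` near `0`. By
hermiticity, `⟨φ, φ⟩ λ = ⟨φ, Aφ⟩ + ⟨Aφ, w - φ⟩` (`Matrix.eigenvalue_eventuallyEq`). The first term
is even in `γ` because `φ` and `H` are real, and the second is a pairing of two quantities vanishing
at `0`; hence `0` is critical.

Now take a form `u` carried by the edges at `x₀`, with values `b y` such that `∑ h_{x₀,y} b y φ y =
0`. Since `φ x₀ = 0`, moving along `u` does not change `⟨φ, Aφ⟩`, and the derivative of `Aφ` along
`u` is zero. The eigenvalue equation then gives `∂_u w = 0`, so `u` lies in the kernel of the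
Hessian (`Matrix.fderiv_fderiv_eigenvalue_eq_zero`).

The constraint on `b` costs at most one dimension of `deg x₀`. If such a `u` is a gradient `df`,
then `(f - f x₀) φ` is in the kernel of `H`, so `b` is constant: gauge costs at most one more. The
nullity is thus at least `n_+ + n_- - 2`. As `(Hφ)(x₀) = 0`, the numbers `n_±` are both zero or both
positive, and the bound by `|n_+ - n_-|` follows. -/

/-! ### Weyl's inequality for ordered eigenvalues. -/

section Weyl

variable {E : Type*} [NormedAddCommGroup E] [InnerProductSpace ℂ E] [FiniteDimensional ℂ E]

open scoped InnerProductSpace in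
theorem LinearMap.IsSymmetric.re_inner_apply_eq_sum_eigenvalues {T : E →ₗ[ℂ] E} {N : ℕ}
    (hT : T.IsSymmetric) (hN : Module.finrank ℂ E = N) (x : E) :
    (⟪x, T x⟫_ℂ).re =
      ∑ i, hT.eigenvalues hN i * ‖(hT.eigenvectorBasis hN).repr x i‖ ^ 2 := by
  rw [← (hT.eigenvectorBasis hN).repr.inner_map_map, PiLp.inner_apply, Complex.re_sum]
  refine Finset.sum_congr rfl fun i _ => ?_
  rw [hT.eigenvectorBasis_apply_self_apply hN, RCLike.inner_apply]
  change ((hT.eigenvalues hN i : ℂ) * _ * (starRingEnd ℂ) _).re = _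
  rw [mul_assoc, Complex.mul_conj, Complex.normSq_eq_norm_sq, ← Complex.ofReal_mul,
    Complex.ofReal_re]

open scoped InnerProductSpace in
/-- Weyl's monotonicity principle. -/
theorem LinearMap.IsSymmetric.eigenvalues_le_eigenvalues_add {T S : E →ₗ[ℂ] E} {N : ℕ}
    (hT : T.IsSymmetric) (hS : S.IsSymmetric) (hN : Module.finrank ℂ E = N) {ε : ℝ}
    (h : ∀ x, (⟪x, T x⟫_ℂ).re ≤ (⟪x, S x⟫_ℂ).re + ε * ‖x‖ ^ 2) (k : Fin N) :
    hT.eigenvalues hN k ≤ hS.eigenvalues hN k + ε := by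
  classical
  set b := hT.eigenvectorBasis hN
  set b' := hS.eigenvectorBasis hN
  -- Eigenvalues are indexed in decreasing order. A kernel vector of `f` is a combination of the top
  -- `k + 1` eigenvectors of `T` orthogonal to the top `k` of `S`; its Rayleigh quotient is at least
  -- the `k`-th eigenvalue for `T` and at most that for `S`.
  let f : ({i // i ≤ k} → ℂ) →ₗ[ℂ] ({i // i < k} → ℂ) :=
    { toFun := fun c j => b'.repr (∑ i, c i • b i) j
      map_add' := fun c c' => by
        ext j
        simp [add_smul, Finset.sum_add_distrib]
      map_smul' := fun r c => by
        ext j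
        simp [mul_smul, ← Finset.smul_sum, Finset.mul_sum] }
  have hcard : Module.finrank ℂ ({i // i < k} → ℂ) < Module.finrank ℂ ({i // i ≤ k} → ℂ) := by
    simp only [Module.finrank_fintype_fun_eq_card]
    exact Fintype.card_subtype_lt (p := fun i : {i // i ≤ k} => i.1 < k)
      (x := ⟨k, le_rfl⟩) (lt_irrefl k) |>.trans_le' (by
        refine Fintype.card_le_of_injective
          (fun i => ⟨⟨i.1, i.2.le⟩, i.2⟩) fun i j hij => ?_
        simpa [Subtype.ext_iff] using hij)
  obtain ⟨c, hc, hc0⟩ := (Submodule.ne_bot_iff _).1 (LinearMap.ker_ne_bot_of_finrank_lt hcard (f := f))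
  set x := ∑ i, c i • b i.1 with hx
  have hxS : ∀ i, i < k → b'.repr x i = 0 := fun i hi =>
    congrFun (LinearMap.mem_ker.1 hc) ⟨i, hi⟩
  have hxT : ∀ i, b.repr x i = if hi : i ≤ k then c ⟨i, hi⟩ else 0 := by
    intro i
    rw [b.repr_apply_apply, hx, inner_sum]
    simp only [inner_smul_right, b.inner_eq_ite]
    split_ifs with hi
    · rw [Finset.sum_eq_single ⟨i, hi⟩]
      · simp
      · intro j _ hj
        rw [if_neg (fun e => hj (Subtype.ext e.symm)), mul_zero]
      · simp
    · refine Finset.sum_eq_zero fun j _ => ?_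
      rw [if_neg (fun e : i = j.1 => hi (e ▸ j.2)), mul_zero]
  have hx0 : 0 < ‖x‖ ^ 2 := by
    obtain ⟨i, hi⟩ := Function.ne_iff.1 hc0
    have : x ≠ 0 := fun e => hi (by have := hxT i; rw [dif_pos i.2, e] at this; simpa using this.symm)
    positivity
  have hnorm : ∀ B : OrthonormalBasis (Fin N) ℂ E, ‖x‖ ^ 2 = ∑ i, ‖B.repr x i‖ ^ 2 := fun B => by
    rw [← B.repr.norm_map, EuclideanSpace.norm_sq_eq]
  have h1 : hT.eigenvalues hN k * ‖x‖ ^ 2 ≤ (⟪x, T x⟫_ℂ).re := by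
    rw [hT.re_inner_apply_eq_sum_eigenvalues hN, hnorm b, Finset.mul_sum]
    refine Finset.sum_le_sum fun i _ => ?_
    by_cases hi : i ≤ k
    · exact mul_le_mul_of_nonneg_right (hT.eigenvalues_antitone hN hi) (by positivity)
    · rw [show (hT.eigenvectorBasis hN).repr x i = 0 from (hxT i).trans (dif_neg hi)]
      simp
  have h2 : (⟪x, S x⟫_ℂ).re ≤ hS.eigenvalues hN k * ‖x‖ ^ 2 := by
    rw [hS.re_inner_apply_eq_sum_eigenvalues hN, hnorm b', Finset.mul_sum]
    refine Finset.sum_le_sum fun i _ => ?_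
    by_cases hi : i < k
    · rw [show (hS.eigenvectorBasis hN).repr x i = 0 from hxS i hi]
      simp
    · exact mul_le_mul_of_nonneg_right (hS.eigenvalues_antitone hN (not_lt.1 hi)) (by positivity)
  have h3 := h x
  refine le_of_mul_le_mul_right ?_ hx0
  linarith

/-- Weyl's perturbation inequality. -/
theorem LinearMap.IsSymmetric.abs_eigenvalues_sub_le {T S : E →L[ℂ] E} {N : ℕ}
    (hT : (T : E →ₗ[ℂ] E).IsSymmetric) (hS : (S : E →ₗ[ℂ] E).IsSymmetric)
    (hN : Module.finrank ℂ E = N) (k : Fin N) :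
    |hT.eigenvalues hN k - hS.eigenvalues hN k| ≤ ‖T - S‖ := by
  have key : ∀ T S : E →L[ℂ] E, ∀ x,
      (inner ℂ x (T x)).re ≤ (inner ℂ x (S x)).re + ‖T - S‖ * ‖x‖ ^ 2 := by
    intro T S x
    have h1 : (inner ℂ x ((T - S) x)).re ≤ ‖x‖ * (‖T - S‖ * ‖x‖) :=
      (Complex.re_le_norm _).trans <| (norm_inner_le_norm _ _).trans <|
        mul_le_mul_of_nonneg_left ((T - S).le_opNorm x) (norm_nonneg _)
    change (inner ℂ x (T x - S x)).re ≤ _ at h1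
    rw [inner_sub_right, Complex.sub_re] at h1
    nlinarith
  have h1 := hT.eigenvalues_le_eigenvalues_add hS hN (key T S) k
  have h2 := hS.eigenvalues_le_eigenvalues_add hT hN (key S T) k
  rw [norm_sub_rev] at h2
  rw [abs_le]
  constructor <;> linarith

end Weyl

/-! ### Ordered eigenvalues of Hermitian matrices. -/

section HermitianMatrix

variable {X : Type*} [Fintype X] [DecidableEq X]

/-- The ordered eigenvalues of a continuous family of Hermitian matrices are continuous. -/
theorem Matrix.IsHermitian.continuous_eigenvalues₀ {Y : Type*} [TopologicalSpace Y]
    {A : Y → Matrix X X ℂ} (hA : Continuous A) (h : ∀ v, (A v).IsHermitian)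
    (k : Fin (Fintype.card X)) : Continuous fun v => (h v).eigenvalues₀ k := by
  let T : Y → EuclideanSpace ℂ X →L[ℂ] EuclideanSpace ℂ X := fun v => toEuclideanCLM (𝕜 := ℂ) (A v)
  have hT : Continuous T :=
    ((toEuclideanCLM (n := X) (𝕜 := ℂ)).toAlgEquiv.toLinearMap.continuous_of_finiteDimensional).comp
      hA
  have hS : ∀ v, (T v : EuclideanSpace ℂ X →ₗ[ℂ] EuclideanSpace ℂ X).IsSymmetric := fun v =>
    isSymmetric_toEuclideanLin_iff.mpr (h v)
  rw [continuous_iff_continuousAt]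
  intro v
  rw [ContinuousAt, tendsto_iff_dist_tendsto_zero]
  refine squeeze_zero (fun _ => dist_nonneg)
    (fun u => (hS u).abs_eigenvalues_sub_le (hS v) finrank_euclideanSpace k) ?_
  have := (hT.sub (continuous_const (y := T v))).norm.tendsto v
  simpa using this

theorem Matrix.IsHermitian.exists_eigenvalues₀_eq {A : Matrix X X ℂ} (hA : A.IsHermitian)
    {w : X → ℂ} (hw : w ≠ 0) {t : ℂ} (h : A *ᵥ w = t • w) :
    ∃ k, (hA.eigenvalues₀ k : ℂ) = t := by
  refine LinearMap.IsSymmetric.exists_eigenvalues_eq _ _ ?_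
  refine Module.End.hasEigenvalue_of_hasEigenvector (x := WithLp.toLp 2 w)
    (Module.End.hasEigenvector_iff.2 ⟨Module.End.mem_eigenspace_iff.2 ?_, by simpa using hw⟩)
  rw [toLpLin_toLp, toLin'_apply, h]
  rfl

/-- The number of indices carrying the value `μ` is the dimension of its eigenspace, here at most
one. -/
theorem Matrix.IsHermitian.eq_of_eigenvalues₀_eq_of_simple {A : Matrix X X ℂ}
    (hA : A.IsHermitian) {μ : ℝ} {φ : X → ℂ} (hφ : A *ᵥ φ = (μ : ℂ) • φ)
    (hsimple : ∀ w, A *ᵥ w = (μ : ℂ) • w → ∃ c : ℂ, w = c • φ)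
    {k l : Fin (Fintype.card X)} (hk : hA.eigenvalues₀ k = μ) (hl : hA.eigenvalues₀ l = μ) :
    k = l := by
  have hc := (isSymmetric_toEuclideanLin_iff.mpr hA).card_filter_eigenvalues_eq
    finrank_euclideanSpace (μ : ℂ)
  have h1 : Module.finrank ℂ (Module.End.eigenspace (toEuclideanLin A) (μ : ℂ)) ≤ 1 := by
    refine finrank_le_one ⟨WithLp.toLp 2 φ, Module.End.mem_eigenspace_iff.2 (by
      rw [toLpLin_toLp, toLin'_apply, hφ]; rfl)⟩ fun w => ?_
    obtain ⟨w, hw⟩ := w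
    obtain ⟨c, hc⟩ := hsimple w.ofLp (by
      have := congrArg WithLp.ofLp (Module.End.mem_eigenspace_iff.1 hw)
      simpa using this)
    refine ⟨c, Subtype.ext ?_⟩
    ext x
    simp [hc]
  have h2 := Finset.card_le_one.1 (hc.le.trans h1)
  exact h2 k (Finset.mem_filter.2 ⟨Finset.mem_univ _, congrArg Complex.ofReal hk⟩)
    l (Finset.mem_filter.2 ⟨Finset.mem_univ _, congrArg Complex.ofReal hl⟩)

end HermitianMatrix

/-! ### Smooth continuation of a simple eigenpair. -/

section Perturbation

variable {X : Type*} [Fintype X]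
  {E : Type*} [NormedAddCommGroup E] [NormedSpace ℝ E] [CompleteSpace E]

open scoped Topology ComplexOrder in
/-- A simple eigenvalue `0` of a Hermitian matrix and its eigenvector extend smoothly along a smooth
family of matrices. -/
theorem Matrix.exists_contDiffAt_eigenpair {A : E → Matrix X X ℂ}
    (hA : ∀ i j, ContDiff ℝ ∞ fun v => A v i j) (h0 : (A 0).IsHermitian) {φ : X → ℂ} (hφ0 : φ ≠ 0)
    (hφ : A 0 *ᵥ φ = 0) (hsimple : ∀ w, A 0 *ᵥ w = 0 → ∃ c : ℂ, w = c • φ) :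
    ∃ (w : E → X → ℂ) (t : E → ℂ), ContDiffAt ℝ ∞ w 0 ∧ ContDiffAt ℝ ∞ t 0 ∧ w 0 = φ ∧ t 0 = 0 ∧
      ∀ᶠ v in 𝓝 0, A v *ᵥ w v = t v • w v ∧ star φ ⬝ᵥ w v = star φ ⬝ᵥ φ := by
  have hc : star φ ⬝ᵥ φ ≠ 0 := fun h => hφ0 (dotProduct_star_self_eq_zero.1 h)
  have hleft : ∀ y, star φ ⬝ᵥ (A 0 *ᵥ y) = 0 := fun y => by
    have : star φ ᵥ* A 0 = 0 := by
      rw [← h0.eq, ← star_mulVec, hφ, star_zero]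
    rw [dotProduct_mulVec, this, zero_dotProduct]
  -- The second component fixes the scaling of the eigenvector; without it the derivative in
  -- (vector, eigenvalue) would have a kernel.
  let F : E × ((X → ℂ) × ℂ) → (X → ℂ) × ℂ := fun p =>
    (A p.1 *ᵥ p.2.1 - p.2.2 • p.2.1, star φ ⬝ᵥ p.2.1)
  let u : E × ((X → ℂ) × ℂ) := (0, (φ, 0))
  have hF : ContDiff ℝ ∞ F := by
    refine ContDiff.prodMk (contDiff_pi.2 fun i => ?_) ?_
    · simp only [mulVec, dotProduct, Pi.sub_apply, Pi.smul_apply, smul_eq_mul]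
      refine ContDiff.sub (ContDiff.sum fun j _ => ((hA i j).comp contDiff_fst).mul ?_) ?_ <;>
        fun_prop
    · simp only [dotProduct]
      fun_prop
  have cdf : ContDiffAt ℝ ∞ F u := hF.contDiffAt
  have hpn : (∞ : WithTop ℕ∞) ≠ 0 := by simp
  have hFu : F u = (0, star φ ⬝ᵥ φ) := by simp [F, u, hφ]
  set L := fderiv ℝ F u ∘L .inr ℝ E ((X → ℂ) × ℂ) with hL
  have hLy : ∀ y, L y = (A 0 *ᵥ y.1 - y.2 • φ, star φ ⬝ᵥ y.1) := by
    intro y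
    have h1 : HasDerivAt (fun s : ℝ => u + s • ((0, y) : E × ((X → ℂ) × ℂ))) (0, y) 0 := by
      simpa using ((hasDerivAt_id (0 : ℝ)).smul_const ((0, y) : E × ((X → ℂ) × ℂ))).const_add u
    have h2 : HasDerivAt (fun s : ℝ => F (u + s • ((0, y) : E × ((X → ℂ) × ℂ)))) (L y) 0 := by
      have hd : HasFDerivAt F (fderiv ℝ F u) (u + (0 : ℝ) • ((0, y) : E × ((X → ℂ) × ℂ))) := by
        rw [zero_smul, add_zero]
        exact (cdf.differentiableAt hpn).hasFDerivAt
      exact hd.comp_hasDerivAt (0 : ℝ) h1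
    -- With the parameter frozen, `F` is exactly quadratic along the line, so the derivative is the
    -- coefficient of `s`.
    have h3 : HasDerivAt (fun s : ℝ => F u + (s • ((A 0 *ᵥ y.1 - y.2 • φ, star φ ⬝ᵥ y.1) :
        (X → ℂ) × ℂ) + s ^ 2 • ((-(y.2 • y.1), 0) : (X → ℂ) × ℂ)))
        (A 0 *ᵥ y.1 - y.2 • φ, star φ ⬝ᵥ y.1) 0 := by
      simpa using (((hasDerivAt_id (0 : ℝ)).smul_const
        ((A 0 *ᵥ y.1 - y.2 • φ, star φ ⬝ᵥ y.1) : (X → ℂ) × ℂ)).add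
        ((hasDerivAt_pow 2 (0 : ℝ)).smul_const ((-(y.2 • y.1), 0) : (X → ℂ) × ℂ))).const_add (F u)
    refine (h2.congr_deriv rfl).unique (h3.congr_of_eventuallyEq (Filter.Eventually.of_forall ?_))
    intro s
    refine Prod.ext ?_ ?_
    · ext i
      simp [F, u, mulVec_add, mulVec_smul, hφ]
      ring
    · simp [F, u]
  have hinj : Function.Injective L := by
    rw [injective_iff_map_eq_zero]
    rintro ⟨y, r⟩ hy
    rw [hLy, Prod.mk_eq_zero] at hy
    obtain ⟨hy1, hy2⟩ := hy
    -- Pairing with `φ` kills the range of `A 0` and leaves `r ⟨φ, φ⟩ = 0`.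
    have hr : r = 0 := by
      have := congrArg (star φ ⬝ᵥ ·) hy1
      simp only [dotProduct_sub, hleft, dotProduct_smul, dotProduct_zero, zero_sub, neg_eq_zero,
        smul_eq_mul, mul_eq_zero, hc, or_false] at this
      exact this
    subst hr
    obtain ⟨c, rfl⟩ := hsimple y (by simpa using hy1)
    have : c = 0 := by simpa [dotProduct_smul, hc] using hy2
    simp [this]
  have hinv : L.IsInvertible := by
    refine ⟨(LinearEquiv.ofInjectiveEndo (L : _ →ₗ[ℝ] _) hinj).toContinuousLinearEquiv, ?_⟩
    exact ContinuousLinearMap.ext fun y => rfl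
  have happly := cdf.eventually_apply_implicitFunction hpn hinv
  have hself := cdf.implicitFunction_apply_self hpn hinv
  have hsmooth := cdf.contDiffAt_implicitFunction hpn hinv
  refine ⟨fun v => (cdf.implicitFunction hpn hinv v).1, fun v => (cdf.implicitFunction hpn hinv v).2,
    contDiffAt_fst.comp _ hsmooth, contDiffAt_snd.comp _ hsmooth, congrArg Prod.fst hself,
    congrArg Prod.snd hself, ?_⟩
  filter_upwards [happly] with v hv
  rw [hFu] at hv
  exact ⟨sub_eq_zero.1 (congrArg Prod.fst hv), congrArg Prod.snd hv⟩

open scoped Topology in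
/-- An ordered eigenvalue of a smooth family of Hermitian matrices is smooth where it is simple,
and it then comes with a smooth eigenvector. -/
theorem Matrix.IsHermitian.exists_contDiffAt_eigenvector [DecidableEq X] {A : E → Matrix X X ℂ}
    (hA : ∀ i j, ContDiff ℝ ∞ fun v => A v i j) (h : ∀ v, (A v).IsHermitian) {φ : X → ℂ}
    (hφ0 : φ ≠ 0) (hφ : A 0 *ᵥ φ = 0) (hsimple : ∀ w, A 0 *ᵥ w = 0 → ∃ c : ℂ, w = c • φ)
    {k : Fin (Fintype.card X)} (hk : (h 0).eigenvalues₀ k = 0) :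
    ContDiffAt ℝ ∞ (fun v => (h v).eigenvalues₀ k) 0 ∧
    ∃ w : E → X → ℂ, ContDiffAt ℝ ∞ w 0 ∧ w 0 = φ ∧
      ∀ᶠ v in 𝓝 0, A v *ᵥ w v = ((h v).eigenvalues₀ k : ℂ) • w v ∧
        star φ ⬝ᵥ w v = star φ ⬝ᵥ φ := by
  obtain ⟨w, t, hw, ht, hw0, ht0, hwt⟩ := exists_contDiffAt_eigenpair hA (h 0) hφ0 hφ hsimple
  have hcont : ∀ l, Continuous fun v => (h v).eigenvalues₀ l := fun l =>
    continuous_eigenvalues₀ (continuous_matrix fun i j => (hA i j).continuous) h l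
  -- By simplicity the other ordered eigenvalues are nonzero at `0`, so they stay away from `t`
  -- nearby; `t v`, being an eigenvalue, can only be the `k`-th.
  have hne : ∀ l, l ≠ k → ∀ᶠ v in 𝓝 (0 : E), ((h v).eigenvalues₀ l : ℂ) ≠ t v := by
    intro l hl
    have h1 : ((h 0).eigenvalues₀ l : ℂ) - t 0 ≠ 0 := by
      rw [ht0, sub_zero]
      intro h2
      refine hl ((h 0).eq_of_eigenvalues₀_eq_of_simple (μ := 0) (φ := φ) (by simpa using hφ)
        (by simpa using hsimple) (by exact_mod_cast h2) hk)
    have h3 : ContinuousAt (fun v => ((h v).eigenvalues₀ l : ℂ) - t v) 0 :=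
      (Complex.continuous_ofReal.comp (hcont l)).continuousAt.sub ht.continuousAt
    filter_upwards [h3.eventually_ne h1] with v hv
    exact sub_ne_zero.1 hv
  have hw_ne : ∀ᶠ v in 𝓝 (0 : E), w v ≠ 0 := hw.continuousAt.eventually_ne (by rwa [hw0])
  have heq : ∀ᶠ v in 𝓝 (0 : E), ((h v).eigenvalues₀ k : ℂ) = t v := by
    filter_upwards [Filter.eventually_all.2 fun l => Filter.eventually_imp_distrib_left.2 (hne l),
      hw_ne, hwt] with v hv hwv hwtv
    obtain ⟨l, hl⟩ := (h v).exists_eigenvalues₀_eq hwv hwtv.1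
    by_cases hlk : l = k
    · rwa [hlk] at hl
    · exact absurd hl (hv l hlk)
  refine ⟨(Complex.reCLM.contDiff.contDiffAt.comp 0 ht).congr_of_eventuallyEq ?_, w, hw, hw0, ?_⟩
  · filter_upwards [heq] with v hv
    simp [← hv]
  · filter_upwards [heq, hwt] with v hv hwtv
    rwa [hv]

end Perturbation

/-! ### Calculus of second derivatives. -/

section SecondDerivative

variable {E F F' : Type*} [NormedAddCommGroup E] [NormedSpace ℝ E] [NormedAddCommGroup F]
  [NormedSpace ℝ F] [NormedAddCommGroup F'] [NormedSpace ℝ F']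

theorem ContDiffAt.eventually_differentiableAt {f : E → F} {p : E} (hf : ContDiffAt ℝ 2 f p) :
    ∀ᶠ v in nhds p, DifferentiableAt ℝ f v :=
  (hf.eventually (by simp)).mono fun _ h => h.differentiableAt (by simp)

theorem ContDiffAt.differentiableAt_fderiv {f : E → F} {p : E} (hf : ContDiffAt ℝ 2 f p) :
    DifferentiableAt ℝ (fderiv ℝ f) p :=
  (hf.fderiv_right (m := 1) (by norm_num)).differentiableAt (by simp)

theorem fderiv_fderiv_add {f g : E → F} {p : E} (hf : ContDiffAt ℝ 2 f p)
    (hg : ContDiffAt ℝ 2 g p) :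
    fderiv ℝ (fderiv ℝ fun v => f v + g v) p =
      fderiv ℝ (fderiv ℝ f) p + fderiv ℝ (fderiv ℝ g) p := by
  have : fderiv ℝ (fun v => f v + g v) =ᶠ[nhds p] fun v => fderiv ℝ f v + fderiv ℝ g v := by
    filter_upwards [hf.eventually_differentiableAt, hg.eventually_differentiableAt] with v h1 h2
    exact fderiv_fun_add h1 h2
  rw [this.fderiv_eq, fderiv_fun_add hf.differentiableAt_fderiv hg.differentiableAt_fderiv]

theorem fderiv_fderiv_sum {ι : Type*} {s : Finset ι} {f : ι → E → F} {p : E}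
    (hf : ∀ i ∈ s, ContDiffAt ℝ 2 (f i) p) :
    fderiv ℝ (fderiv ℝ fun v => ∑ i ∈ s, f i v) p = ∑ i ∈ s, fderiv ℝ (fderiv ℝ (f i)) p := by
  have : fderiv ℝ (fun v => ∑ i ∈ s, f i v) =ᶠ[nhds p] fun v => ∑ i ∈ s, fderiv ℝ (f i) v := by
    filter_upwards [(Finset.eventually_all s).2 fun i hi => (hf i hi).eventually_differentiableAt]
      with v h
    exact fderiv_fun_sum h
  rw [this.fderiv_eq, fderiv_fun_sum fun i hi => (hf i hi).differentiableAt_fderiv]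

theorem fderiv_fderiv_clm_comp (L : F →L[ℝ] F') {f : E → F} {p : E} (hf : ContDiffAt ℝ 2 f p)
    (u v : E) :
    fderiv ℝ (fderiv ℝ fun x => L (f x)) p u v = L (fderiv ℝ (fderiv ℝ f) p u v) := by
  have : fderiv ℝ (fun x => L (f x)) =ᶠ[nhds p]
      fun x => ContinuousLinearMap.compL ℝ E F F' L (fderiv ℝ f x) := by
    filter_upwards [hf.eventually_differentiableAt] with x hx
    exact (L.hasFDerivAt.comp x hx.hasFDerivAt).fderiv
  rw [this.fderiv_eq]
  exact congrArg (fun M => M u v) ((ContinuousLinearMap.compL ℝ E F F' L).hasFDerivAt.comp p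
    hf.differentiableAt_fderiv.hasFDerivAt).fderiv

theorem fderiv_fderiv_comp_clm (L : E →L[ℝ] F) {f : F → F'} {p : E}
    (hf : ContDiffAt ℝ 2 f (L p)) (u v : E) :
    fderiv ℝ (fderiv ℝ fun x => f (L x)) p u v = fderiv ℝ (fderiv ℝ f) (L p) (L u) (L v) := by
  have : fderiv ℝ (fun x => f (L x)) =ᶠ[nhds p]
      fun x => (ContinuousLinearMap.compL ℝ E F F').flip L (fderiv ℝ f (L x)) := by
    filter_upwards [L.continuous.continuousAt.eventually hf.eventually_differentiableAt] with x hx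
    exact (hx.hasFDerivAt.comp x L.hasFDerivAt).fderiv
  rw [this.fderiv_eq]
  exact congrArg (fun M => M u v)
    (((ContinuousLinearMap.compL ℝ E F F').flip L).hasFDerivAt.comp p
      (hf.differentiableAt_fderiv.hasFDerivAt.comp p L.hasFDerivAt)).fderiv

/-- Only cross terms survive, so a direction killed by both first derivatives is degenerate for the
product. -/
theorem fderiv_fderiv_mul_of_eq_zero {f g : E → ℂ} {p : E} (hf : ContDiffAt ℝ 2 f p)
    (hg : ContDiffAt ℝ 2 g p) (hf0 : f p = 0) (hg0 : g p = 0) (u v : E) :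
    fderiv ℝ (fderiv ℝ fun x => f x * g x) p u v =
      fderiv ℝ f p u * fderiv ℝ g p v + fderiv ℝ g p u * fderiv ℝ f p v := by
  have : fderiv ℝ (fun x => f x * g x) =ᶠ[nhds p]
      fun x => f x • fderiv ℝ g x + g x • fderiv ℝ f x := by
    filter_upwards [hf.eventually_differentiableAt, hg.eventually_differentiableAt] with v h1 h2
    exact fderiv_fun_mul h1 h2
  have hf1 := hf.differentiableAt (by simp)
  have hg1 := hg.differentiableAt (by simp)
  have hf2 := hf.differentiableAt_fderiv
  have hg2 := hg.differentiableAt_fderiv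
  rw [this.fderiv_eq, fderiv_fun_add (hf1.fun_smul hg2) (hg1.fun_smul hf2), fderiv_fun_smul hf1 hg2,
    fderiv_fun_smul hg1 hf2]
  simp [hf0, hg0]

theorem fderiv_eq_zero_of_even {f : E → F} (hf : ∀ v, f (-v) = f v) : fderiv ℝ f 0 = 0 := by
  have h := fderiv_comp_smul (𝕜 := ℝ) (f := f) (x := 0) (-1 : ℝ)
  simp only [neg_one_smul, hf, neg_zero] at h
  have h2 : (2 : ℝ) • fderiv ℝ f 0 = 0 := by
    rw [two_smul]
    nth_rewrite 1 [h]
    exact neg_add_cancel _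
  exact (smul_eq_zero.1 h2).resolve_left two_ne_zero

/-- The first derivative inherits the invariance, hence is constant along the line through `p` in
direction `u`. -/
theorem fderiv_fderiv_eq_zero_of_translation_invariant {f : E → F} {p u : E}
    (hf : ContDiffAt ℝ 2 f p) (h : ∀ (s : ℝ) v, f (v + s • u) = f v) :
    fderiv ℝ (fderiv ℝ f) p u = 0 := by
  have h1 : HasDerivAt (fun s : ℝ => p + s • u) u 0 := by
    simpa using ((hasDerivAt_id (0 : ℝ)).smul_const u).const_add p
  have h2 : HasDerivAt (fun s : ℝ => fderiv ℝ f (p + s • u)) (fderiv ℝ (fderiv ℝ f) p u) 0 := by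
    have : HasFDerivAt (fderiv ℝ f) (fderiv ℝ (fderiv ℝ f) p) (p + (0 : ℝ) • u) := by
      rw [zero_smul, add_zero]
      exact hf.differentiableAt_fderiv.hasFDerivAt
    exact this.comp_hasDerivAt (0 : ℝ) h1
  have h3 : (fun s : ℝ => fderiv ℝ f (p + s • u)) = fun _ => fderiv ℝ f p := by
    funext s
    rw [← fderiv_comp_add_right]
    simp only [h]
  rw [h3] at h2
  exact h2.unique (hasDerivAt_const _ _)

end SecondDerivative

/-! ### First and second derivatives of a simple eigenvalue. -/

section EigenvalueDerivatives

variable {X : Type*} [Fintype X] {E : Type*} [NormedAddCommGroup E]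

open scoped Topology

variable {A : E → Matrix X X ℂ} {φ : X → ℂ} {l : E → ℝ} {w : E → X → ℂ}

/-- Along a family of Hermitian matrices, the eigenvalue is the sum of the quadratic form of the
unperturbed eigenvector and of a term of second order. -/
theorem Matrix.eigenvalue_eventuallyEq (hherm : ∀ v, (A v).IsHermitian)
    (hw : ∀ᶠ v in 𝓝 0, A v *ᵥ w v = (l v : ℂ) • w v ∧ star φ ⬝ᵥ w v = star φ ⬝ᵥ φ) :
    (fun v => (star φ ⬝ᵥ φ) * (l v : ℂ)) =ᶠ[𝓝 0] fun v => star φ ⬝ᵥ A v *ᵥ φ +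
      ∑ j, star ((A v *ᵥ φ) j) * (w v j - φ j) := by
  filter_upwards [hw] with v hv
  -- By hermiticity the two terms add up to `⟨φ, A w⟩ = l ⟨φ, w⟩`, and the normalization turns `⟨φ,
  -- w⟩` into `⟨φ, φ⟩`.
  have h1 : ∑ j, star ((A v *ᵥ φ) j) * (w v j - φ j) = star φ ⬝ᵥ A v *ᵥ (w v - φ) := by
    rw [dotProduct_mulVec, ← (hherm v).eq, ← star_mulVec, (hherm v).eq]
    rfl
  rw [h1, ← dotProduct_add, ← mulVec_add, add_sub_cancel, hv.1, dotProduct_smul, hv.2, smul_eq_mul,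
    mul_comm]

variable [NormedSpace ℝ E]

theorem Matrix.contDiff_mulVec_apply (hA : ∀ i j, ContDiff ℝ ∞ fun v => A v i j) (i : X) :
    ContDiff ℝ ∞ fun v => (A v *ᵥ φ) i := by
  simp only [mulVec, dotProduct]
  exact ContDiff.sum fun j _ => (hA i j).mul contDiff_const

theorem Matrix.contDiff_dotProduct_mulVec (hA : ∀ i j, ContDiff ℝ ∞ fun v => A v i j) :
    ContDiff ℝ ∞ fun v => star φ ⬝ᵥ A v *ᵥ φ :=
  ContDiff.sum fun i _ => contDiff_const.mul (contDiff_mulVec_apply hA i)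

/-- An eigenvalue is critical if the quadratic form of the unperturbed eigenvector is even. -/
theorem Matrix.fderiv_eigenvalue_eq_zero (hA : ∀ i j, ContDiff ℝ ∞ fun v => A v i j)
    (hherm : ∀ v, (A v).IsHermitian) (hφ0 : star φ ⬝ᵥ φ ≠ 0) (hφ : A 0 *ᵥ φ = 0)
    (hl : ContDiffAt ℝ ∞ l 0) (hwc : ContDiffAt ℝ ∞ w 0) (hw0 : w 0 = φ)
    (hw : ∀ᶠ v in 𝓝 0, A v *ᵥ w v = (l v : ℂ) • w v ∧ star φ ⬝ᵥ w v = star φ ⬝ᵥ φ)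
    (heven : ∀ v, star φ ⬝ᵥ A (-v) *ᵥ φ = star φ ⬝ᵥ A v *ᵥ φ) :
    fderiv ℝ l 0 = 0 := by
  have h1 := (eigenvalue_eventuallyEq hherm hw).fderiv_eq (𝕜 := ℝ)
  have hq : HasFDerivAt (fun v => star φ ⬝ᵥ A v *ᵥ φ) (0 : E →L[ℝ] ℂ) 0 := by
    rw [← fderiv_eq_zero_of_even (f := fun v => star φ ⬝ᵥ A v *ᵥ φ) heven]
    exact ((contDiff_dotProduct_mulVec hA).differentiable (by simp) 0).hasFDerivAt
  have hs : ∀ j, HasFDerivAt (fun v => star ((A v *ᵥ φ) j) * (w v j - φ j)) (0 : E →L[ℝ] ℂ) 0 := by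
    intro j
    have ha := ((contDiff_mulVec_apply (φ := φ) hA j).differentiable (by simp) 0).hasFDerivAt.star
    have hb := (((contDiffAt_pi.1 hwc j).differentiableAt (by simp)).hasFDerivAt).sub_const (φ j)
    refine (ha.mul hb).congr_fderiv ?_
    ext v
    simp [hφ, hw0]
  have h2 := (hq.add (HasFDerivAt.fun_sum fun j (_ : j ∈ Finset.univ) => hs j)).fderiv
  have h3 := ((Complex.ofRealCLM.hasFDerivAt.comp 0
    (hl.differentiableAt (by simp)).hasFDerivAt).const_mul (star φ ⬝ᵥ φ)).fderiv
  have h4 := h3.symm.trans (h1.trans h2)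
  ext v
  have h5 := congrArg (fun L : E →L[ℝ] ℂ => L v) h4
  simpa [hφ0] using h5

/-- A direction in which the unperturbed eigenvector is annihilated to first order does not move the
eigenvector to first order. -/
theorem Matrix.fderiv_eigenvector_eq_zero (hA : ∀ i j, ContDiff ℝ ∞ fun v => A v i j)
    (hφ0 : star φ ⬝ᵥ φ ≠ 0) (hsimple : ∀ y, A 0 *ᵥ y = 0 → ∃ c : ℂ, y = c • φ)
    (hl : ContDiffAt ℝ ∞ l 0) (hl0 : l 0 = 0) (hl' : fderiv ℝ l 0 = 0)
    (hwc : ContDiffAt ℝ ∞ w 0) (hw0 : w 0 = φ)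
    (hw : ∀ᶠ v in 𝓝 0, A v *ᵥ w v = (l v : ℂ) • w v ∧ star φ ⬝ᵥ w v = star φ ⬝ᵥ φ)
    {u : E} (hu : ∀ j, fderiv ℝ (fun v => (A v *ᵥ φ) j) 0 u = 0) (j : X) :
    fderiv ℝ (fun v => w v j) 0 u = 0 := by
  have hwd : ∀ j, HasFDerivAt (fun v => w v j) (fderiv ℝ (fun v => w v j) 0) 0 := fun j =>
    ((contDiffAt_pi.1 hwc j).differentiableAt (by simp)).hasFDerivAt
  have hAd : ∀ i j, HasFDerivAt (fun v => A v i j) (fderiv ℝ (fun v => A v i j) 0) 0 := fun i j =>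
    ((hA i j).differentiable (by simp) 0).hasFDerivAt
  -- Differentiating `A w = l w` along `u` leaves `A(0) ∂_u w = 0`, since `(∂_u A) φ`, `l 0` and
  -- `∂_u l` vanish.
  have hker : A 0 *ᵥ (fun j => fderiv ℝ (fun v => w v j) 0 u) = 0 := by
    funext i
    have h1 : (fun v => ∑ j, A v i j * w v j) =ᶠ[𝓝 0] fun v => (l v : ℂ) * w v i := by
      filter_upwards [hw] with v hv
      exact congrFun hv.1 i
    have h2 := HasFDerivAt.fun_sum fun j (_ : j ∈ Finset.univ) => (hAd i j).mul (hwd j)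
    have h3 := (Complex.ofRealCLM.hasFDerivAt.comp 0
      (hl.differentiableAt (by simp)).hasFDerivAt).mul (hwd i)
    have h4 := congrArg (fun L : E →L[ℝ] ℂ => L u)
      (h2.fderiv.symm.trans (h1.fderiv_eq.trans h3.fderiv))
    have h5 : ∑ j, fderiv ℝ (fun v => A v i j) 0 u * φ j = 0 := by
      rw [← hu i]
      have := HasFDerivAt.fun_sum fun j (_ : j ∈ Finset.univ) => (hAd i j).mul_const (φ j)
      rw [show (fun v => (A v *ᵥ φ) i) = fun v => ∑ j, A v i j * φ j from rfl, this.fderiv]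
      simp [mul_comm]
    simp [Finset.sum_add_distrib, hl0, hl', hw0] at h4
    simp only [mul_comm] at h4 h5
    rw [h5, add_zero] at h4
    simpa [mulVec, dotProduct, mul_comm] using h4
  -- The normalization makes `∂_u w` orthogonal to `φ`, which removes the remaining multiple of `φ`.
  have hort : star φ ⬝ᵥ (fun j => fderiv ℝ (fun v => w v j) 0 u) = 0 := by
    have h1 : (fun v => ∑ j, star φ j * w v j) =ᶠ[𝓝 0] fun v => star φ ⬝ᵥ φ := by
      filter_upwards [hw] with v hv
      exact hv.2
    have h2 := HasFDerivAt.fun_sum fun j (_ : j ∈ Finset.univ) => (hwd j).const_mul (star φ j)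
    have h4 := congrArg (fun L : E →L[ℝ] ℂ => L u) (h2.fderiv.symm.trans h1.fderiv_eq)
    simpa [dotProduct] using h4
  obtain ⟨c, hc⟩ := hsimple _ hker
  rw [hc, dotProduct_smul, smul_eq_mul, mul_eq_zero, or_iff_left hφ0] at hort
  simpa [hort] using congrFun hc j

/-- Degenerate directions of the Hessian of a simple eigenvalue. -/
theorem Matrix.fderiv_fderiv_eigenvalue_eq_zero (hA : ∀ i j, ContDiff ℝ ∞ fun v => A v i j)
    (hherm : ∀ v, (A v).IsHermitian) (hφ0 : star φ ⬝ᵥ φ ≠ 0) (hφ : A 0 *ᵥ φ = 0)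
    (hsimple : ∀ y, A 0 *ᵥ y = 0 → ∃ c : ℂ, y = c • φ)
    (hl : ContDiffAt ℝ ∞ l 0) (hl0 : l 0 = 0) (hl' : fderiv ℝ l 0 = 0)
    (hwc : ContDiffAt ℝ ∞ w 0) (hw0 : w 0 = φ)
    (hw : ∀ᶠ v in 𝓝 0, A v *ᵥ w v = (l v : ℂ) • w v ∧ star φ ⬝ᵥ w v = star φ ⬝ᵥ φ)
    {u : E} (hu : ∀ j, fderiv ℝ (fun v => (A v *ᵥ φ) j) 0 u = 0)
    (hinv : ∀ (s : ℝ) v, star φ ⬝ᵥ A (v + s • u) *ᵥ φ = star φ ⬝ᵥ A v *ᵥ φ) :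
    fderiv ℝ (fderiv ℝ l) 0 u = 0 := by
  have h2 : (2 : WithTop ℕ∞) ≤ ∞ := WithTop.coe_le_coe.2 le_top
  have hwu := fderiv_eigenvector_eq_zero hA hφ0 hsimple hl hl0 hl' hwc hw0 hw hu
  have hq : ContDiffAt ℝ 2 (fun v => star φ ⬝ᵥ A v *ᵥ φ) 0 :=
    (contDiff_dotProduct_mulVec hA).contDiffAt.of_le h2
  have ha : ∀ j, ContDiffAt ℝ 2 (fun v => (A v *ᵥ φ) j) 0 := fun j =>
    (contDiff_mulVec_apply hA j).contDiffAt.of_le h2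
  have ha' : ∀ j, ContDiffAt ℝ 2 (fun v => star ((A v *ᵥ φ) j)) 0 := fun j =>
    (starL' ℝ : ℂ ≃L[ℝ] ℂ).contDiff.contDiffAt.comp 0 (ha j)
  have hz : ∀ j, ContDiffAt ℝ 2 (fun v => w v j - φ j) 0 := fun j =>
    ((contDiffAt_pi.1 hwc j).of_le h2).sub contDiffAt_const
  have hau : ∀ j, fderiv ℝ (fun v => star ((A v *ᵥ φ) j)) 0 u = 0 := fun j => by
    rw [((ha j).differentiableAt (by simp)).hasFDerivAt.star.fderiv]
    simp [hu]
  have h3 := (eigenvalue_eventuallyEq hherm hw).fderiv (𝕜 := ℝ) |>.fderiv_eq (𝕜 := ℝ)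
  rw [fderiv_fderiv_add hq (ContDiffAt.sum fun j _ => (ha' j).mul (hz j)),
    fderiv_fderiv_sum fun j _ => (ha' j).mul (hz j)] at h3
  ext v
  have h4 := congrArg (fun L : E →L[ℝ] E →L[ℝ] ℂ => L u v) h3
  have h5 := fderiv_fderiv_clm_comp ((star φ ⬝ᵥ φ) • Complex.ofRealCLM) (hl.of_le h2) u v
  have h6 : ∀ j, fderiv ℝ (fderiv ℝ fun v => star ((A v *ᵥ φ) j) * (w v j - φ j)) 0 u v = 0 := by
    intro j
    rw [fderiv_fderiv_mul_of_eq_zero (ha' j) (hz j) (by simp [hφ]) (by simp [hw0]), hau,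
      fderiv_sub_const, hwu]
    simp
  have h7 : (star φ ⬝ᵥ φ) * (fderiv ℝ (fderiv ℝ l) 0 u v : ℂ) = 0 := by
    refine h5.symm.trans (h4.trans ?_)
    simp
    rw [fderiv_fderiv_eq_zero_of_translation_invariant hq hinv]
    exact (zero_add _).trans (Finset.sum_eq_zero fun j _ => h6 j)
  simpa [hφ0] using h7

end EigenvalueDerivatives

noncomputable section
namespace MagneticGraph

/-! ### From a simple real kernel to a simple complex kernel. -/

section Complexification

variable {X : Type*} [Fintype X]

/-- The complexification of a real matrix acts on real and imaginary parts. -/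
theorem map_ofReal_mulVec_eq_zero_iff (M : Matrix X X ℝ) (w : X → ℂ) :
    M.map (fun r => (r : ℂ)) *ᵥ w = 0 ↔
      M *ᵥ (fun x => (w x).re) = 0 ∧ M *ᵥ (fun x => (w x).im) = 0 := by
  simp only [funext_iff, ← forall_and]
  refine forall_congr' fun x => ?_
  simp [Matrix.mulVec, dotProduct, Complex.ext_iff]

theorem exists_eq_smul_of_map_ofReal_mulVec_eq_zero {M : Matrix X X ℝ} {φ : X → ℝ}
    (hsimple : ∀ y, M *ᵥ y = 0 → ∃ c : ℝ, y = c • φ) {w : X → ℂ}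
    (hw : M.map (fun r => (r : ℂ)) *ᵥ w = 0) : ∃ c : ℂ, w = c • fun x => (φ x : ℂ) := by
  obtain ⟨h1, h2⟩ := (map_ofReal_mulVec_eq_zero_iff M w).1 hw
  obtain ⟨a, ha⟩ := hsimple _ h1
  obtain ⟨b, hb⟩ := hsimple _ h2
  refine ⟨⟨a, b⟩, funext fun x => Complex.ext ?_ ?_⟩
  · simpa using congrFun ha x
  · simpa using congrFun hb x

end Complexification

/-! ### The magnetic matrix as a function of the potential. -/

section Potential

variable {X : Type*} (G : SimpleGraph X)

open Classical in
/-- The value of a `1`-form at a pair of vertices, zero off the edges. -/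
def formAt (x y : X) : oneForms G →ₗ[ℝ] ℝ where
  toFun γ := if h : G.Adj x y then (γ : G.Dart → ℝ) ⟨(x, y), h⟩ else 0
  map_add' γ γ' := by
    split_ifs <;> simp
  map_smul' c γ := by
    split_ifs <;> simp

variable {G}

theorem formAt_swap (x y : X) (γ : oneForms G) : formAt G y x γ = -formAt G x y γ := by
  simp only [formAt, LinearMap.coe_mk, AddHom.coe_mk]
  by_cases h : G.Adj x y
  · rw [dif_pos h, dif_pos h.symm]
    exact γ.2 ⟨(x, y), h⟩
  · rw [dif_neg h, dif_neg fun k => h k.symm, neg_zero]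

theorem formAt_of_not_adj {x y : X} (h : ¬ G.Adj x y) (γ : oneForms G) : formAt G x y γ = 0 :=
  dif_neg h

theorem formAt_of_adj {x y : X} (h : G.Adj x y) (γ : oneForms G) :
    formAt G x y γ = (γ : G.Dart → ℝ) ⟨(x, y), h⟩ :=
  dif_pos h

theorem formAt_d {x y : X} (h : G.Adj x y) (f : X → ℝ) : formAt G x y (d G f) = f y - f x :=
  dif_pos h

theorem expField_zero : expField G 0 = 1 := by
  ext e
  simp [expField]

variable [DecidableEq X]

/-- The default value zero of `formAt` gives phase `1` off the edges, so one formula also covers the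
diagonal and the vanishing entries. -/
theorem magneticMatrix_expField (H : SchrodingerOperator G) (γ : oneForms G) (x y : X) :
    magneticMatrix H (expField G γ) x y =
      (H.mat x y : ℂ) * Complex.exp (formAt G x y γ * Complex.I) := by
  unfold magneticMatrix
  by_cases h : G.Adj x y
  · rw [dif_pos h, formAt_of_adj h]
    rfl
  · rw [dif_neg h, formAt_of_not_adj h]
    split_ifs with hxy
    · simp [hxy]
    · simp [H.zero_of_not_adj x y hxy h]

theorem magneticMatrix_expField_zero (H : SchrodingerOperator G) :
    magneticMatrix H (expField G 0) = H.mat.map (fun r => (r : ℂ)) := by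
  ext x y
  simp [magneticMatrix_expField]

variable [Fintype X]

theorem contDiff_magneticMatrix_expField [DecidableRel G.Adj] (H : SchrodingerOperator G)
    (x y : X) : ContDiff ℝ ∞ fun γ : oneForms G => magneticMatrix H (expField G γ) x y := by
  simp only [magneticMatrix_expField]
  have h : ContDiff ℝ ∞ (formAt G x y) := (formAt G x y).toContinuousLinearMap.contDiff
  refine contDiff_const.mul (ContDiff.cexp (ContDiff.mul ?_ contDiff_const))
  exact Complex.ofRealCLM.contDiff.comp h

variable (H : SchrodingerOperator G) (φ : X → ℝ)

/-- The quadratic form of a real vector is an even function of the magnetic potential. -/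
theorem dotProduct_magneticMatrix_expField_neg (γ : oneForms G) :
    star (fun x => (φ x : ℂ)) ⬝ᵥ magneticMatrix H (expField G (-γ)) *ᵥ (fun x => (φ x : ℂ)) =
      star (fun x => (φ x : ℂ)) ⬝ᵥ magneticMatrix H (expField G γ) *ᵥ (fun x => (φ x : ℂ)) := by
  simp only [dotProduct, Matrix.mulVec, Finset.mul_sum, Pi.star_apply, Complex.star_def,
    Complex.conj_ofReal]
  -- Exchanging the two vertices absorbs the sign of `γ`, by antisymmetry of `γ` and symmetry of
  -- `H`.
  rw [Finset.sum_comm]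
  refine Finset.sum_congr rfl fun y _ => Finset.sum_congr rfl fun x _ => ?_
  rw [magneticMatrix_expField, magneticMatrix_expField, map_neg, ← formAt_swap, H.symm.apply]
  ring

/-- A potential supported on the pairs where `φ` vanishes at an end does not change the quadratic
form of `φ`. -/
theorem dotProduct_magneticMatrix_expField_add_smul {u : oneForms G}
    (hu : ∀ x y, φ x ≠ 0 → φ y ≠ 0 → formAt G x y u = 0) (s : ℝ) (γ : oneForms G) :
    star (fun x => (φ x : ℂ)) ⬝ᵥ magneticMatrix H (expField G (γ + s • u)) *ᵥ
        (fun x => (φ x : ℂ)) =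
      star (fun x => (φ x : ℂ)) ⬝ᵥ magneticMatrix H (expField G γ) *ᵥ (fun x => (φ x : ℂ)) := by
  simp only [dotProduct, Matrix.mulVec, Finset.mul_sum, Pi.star_apply, Complex.star_def,
    Complex.conj_ofReal]
  refine Finset.sum_congr rfl fun x _ => Finset.sum_congr rfl fun y _ => ?_
  by_cases hx : φ x = 0
  · simp [hx]
  by_cases hy : φ y = 0
  · simp [hy]
  rw [magneticMatrix_expField, magneticMatrix_expField, map_add, map_smul, hu x y hx hy]
  simp

theorem fderiv_magneticMatrix_expField_mulVec [DecidableRel G.Adj] (u : oneForms G) (x : X) :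
    fderiv ℝ (fun γ => (magneticMatrix H (expField G γ) *ᵥ (fun x => (φ x : ℂ))) x) 0 u =
      ((∑ y, H.mat x y * formAt G x y u * φ y : ℝ) : ℂ) * Complex.I := by
  have h : ∀ y, HasFDerivAt (fun γ : oneForms G => magneticMatrix H (expField G γ) x y * (φ y : ℂ))
      ((φ y : ℂ) • (H.mat x y : ℂ) • Complex.I •
        (Complex.ofRealCLM ∘L (formAt G x y).toContinuousLinearMap)) 0 := by
    intro y
    simp only [magneticMatrix_expField]
    have h1 : HasFDerivAt (fun γ : oneForms G => (formAt G x y γ : ℂ))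
        (Complex.ofRealCLM ∘L (formAt G x y).toContinuousLinearMap) 0 :=
      (Complex.ofRealCLM ∘L (formAt G x y).toContinuousLinearMap).hasFDerivAt
    refine ((((h1.mul_const Complex.I).cexp).const_mul (H.mat x y : ℂ)).mul_const
      (φ y : ℂ)).congr_fderiv ?_
    simp
  have h2 := (HasFDerivAt.fun_sum fun y (_ : y ∈ Finset.univ) => h y).fderiv
  rw [show (fun γ : oneForms G => (magneticMatrix H (expField G γ) *ᵥ (fun x => (φ x : ℂ))) x) =
    fun γ => ∑ y, magneticMatrix H (expField G γ) x y * (φ y : ℂ) from rfl, h2]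
  simp [Finset.sum_mul]
  refine Finset.sum_congr rfl fun y _ => ?_
  ring

end Potential

/-! ### Forms supported at the zero of the eigenfunction. -/

section Star

variable {X : Type*} [DecidableEq X] (G : SimpleGraph X) (x₀ : X)

/-- The `1`-form supported on the edges at `x₀` with value `b y` at `[x₀,y]`. -/
def starForm : (X → ℝ) →ₗ[ℝ] oneForms G where
  toFun b := ⟨fun e => if e.fst = x₀ then b e.snd else if e.snd = x₀ then -b e.fst else 0, by
    intro e
    have h : e.fst ≠ e.snd := e.adj.ne
    change (if e.snd = x₀ then b e.fst else if e.fst = x₀ then -b e.snd else 0) =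
      -(if e.fst = x₀ then b e.snd else if e.snd = x₀ then -b e.fst else 0)
    by_cases h1 : e.snd = x₀
    · have h2 : e.fst ≠ x₀ := fun k => h (k.trans h1.symm)
      rw [if_pos h1, if_neg h2, if_pos h1, neg_neg]
    · by_cases h2 : e.fst = x₀ <;> simp [h1, h2]⟩
  map_add' b b' := by
    ext e
    simp only [Submodule.coe_add, Pi.add_apply]
    split_ifs <;> ring
  map_smul' c b := by
    ext e
    simp only [Submodule.coe_smul, Pi.smul_apply, smul_eq_mul, RingHom.id_apply]
    split_ifs <;> ring

variable {G x₀}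

theorem formAt_starForm {y : X} (h : G.Adj x₀ y) (b : X → ℝ) :
    formAt G x₀ y (starForm G x₀ b) = b y :=
  (formAt_of_adj h _).trans (if_pos rfl)

theorem formAt_starForm_of_ne {x y : X} (hx : x ≠ x₀) (hy : y ≠ x₀) (b : X → ℝ) :
    formAt G x y (starForm G x₀ b) = 0 := by
  by_cases h : G.Adj x y
  · exact (formAt_of_adj h _).trans ((if_neg hx).trans (if_neg hy))
  · exact formAt_of_not_adj h _

variable [Fintype X] (H : SchrodingerOperator G) {φ : X → ℝ}

/-- Away from `x₀` only the term `y = x₀` could contribute, and `φ` vanishes there; the row at `x₀`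
is the constraint on `b`. -/
theorem sum_formAt_starForm_eq_zero (hφ : φ x₀ = 0) {b : X → ℝ}
    (hb : ∑ y, H.mat x₀ y * b y * φ y = 0) (x : X) :
    ∑ y, H.mat x y * formAt G x y (starForm G x₀ b) * φ y = 0 := by
  by_cases hx : x = x₀
  · subst hx
    rw [← hb]
    refine Finset.sum_congr rfl fun y _ => ?_
    by_cases h : G.Adj x y
    · rw [formAt_starForm h]
    · by_cases hxy : x = y
      · simp [← hxy, hφ]
      · simp [H.zero_of_not_adj x y hxy h]
  · refine Finset.sum_eq_zero fun y _ => ?_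
    by_cases hy : y = x₀
    · simp [hy, hφ]
    · simp [formAt_starForm_of_ne hx hy]

/-- A gradient annihilating `φ` to first order has a potential that is constant where `φ ≠ 0`, up to
the value at a zero of `φ`. -/
theorem exists_forall_sub_eq_of_sum_formAt_d_eq_zero (hφ : H.mat *ᵥ φ = 0)
    (hsimple : ∀ y, H.mat *ᵥ y = 0 → ∃ c : ℝ, y = c • φ) {f : X → ℝ}
    (hf : ∀ x, ∑ y, H.mat x y * formAt G x y (d G f) * φ y = 0) (x₀ : X) :
    ∃ c, ∀ y, φ y ≠ 0 → f y - f x₀ = c := by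
  -- Subtracting any constant from `f` would do; `f x₀` makes the resulting constant the value of
  -- `df` on `[x₀,y]`.
  have h : H.mat *ᵥ (fun y => (f y - f x₀) * φ y) = 0 := by
    funext x
    have h1 : ∑ y, H.mat x y * φ y = 0 := congrFun hφ x
    have h2 : ∀ y, H.mat x y * ((f y - f x₀) * φ y) =
        H.mat x y * formAt G x y (d G f) * φ y + (f x - f x₀) * (H.mat x y * φ y) := by
      intro y
      by_cases hxy : G.Adj x y
      · rw [formAt_d hxy]
        ring
      · rw [formAt_of_not_adj hxy]
        by_cases he : x = y
        · subst he
          ring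
        · simp [H.zero_of_not_adj x y he hxy]
    simp only [Matrix.mulVec, dotProduct, h2, Finset.sum_add_distrib, hf, ← Finset.mul_sum, h1]
    simp
  obtain ⟨c, hc⟩ := hsimple _ h
  exact ⟨c, fun y hy => mul_right_cancel₀ hy (congrFun hc y)⟩

/-- The star forms annihilating `φ` to first order fill, modulo gauge, a space of dimension at least
the degree of `x₀` minus two. -/
theorem card_adj_le_finrank_add_two [DecidableRel G.Adj] (hφ : H.mat *ᵥ φ = 0)
    (hsimple : ∀ y, H.mat *ᵥ y = 0 → ∃ c : ℝ, y = c • φ) (hx₀ : ∀ x, φ x = 0 ↔ x = x₀)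
    (V : Submodule ℝ (TangentModuli G))
    (hV : ∀ b : X → ℝ, ∑ y, H.mat x₀ y * b y * φ y = 0 →
      (Submodule.Quotient.mk (starForm G x₀ b) : TangentModuli G) ∈ V) :
    Fintype.card {y // G.Adj x₀ y} ≤ Module.finrank ℝ V + 2 := by
  let ext : ({y // G.Adj x₀ y} → ℝ) →ₗ[ℝ] (X → ℝ) :=
    Function.ExtendByZero.linearMap ℝ Subtype.val
  have hext : ∀ a y, ext a y.1 = a y := fun a y => Subtype.val_injective.extend_apply a 0 y
  -- The two lost dimensions are the rank of the constraint `l` and the kernel of `τ`, the star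
  -- forms that are pure gauge; the latter is contained in the constants.
  let l : ({y // G.Adj x₀ y} → ℝ) →ₗ[ℝ] ℝ :=
    (∑ y, (H.mat x₀ y * φ y) • LinearMap.proj y) ∘ₗ ext
  have hl : ∀ a, l a = ∑ y, H.mat x₀ y * ext a y * φ y := fun a => by
    simp only [l, LinearMap.comp_apply, LinearMap.sum_apply, LinearMap.smul_apply,
      LinearMap.proj_apply, smul_eq_mul]
    exact Finset.sum_congr rfl fun y _ => by ring
  let τ : LinearMap.ker l →ₗ[ℝ] TangentModuli G :=
    (Submodule.mkQ _ ∘ₗ starForm G x₀ ∘ₗ ext).domRestrict _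
  have hτ : LinearMap.range τ ≤ V := by
    rintro _ ⟨⟨a, ha⟩, rfl⟩
    exact hV _ ((hl a).symm.trans ha)
  have hker : (LinearMap.ker τ).map (LinearMap.ker l).subtype ≤ Submodule.span ℝ {1} := by
    rintro _ ⟨⟨a, ha⟩, hτa, rfl⟩
    obtain ⟨f, hf⟩ : starForm G x₀ (ext a) ∈ LinearMap.range (d G) :=
      (Submodule.Quotient.mk_eq_zero _).1 hτa
    obtain ⟨c, hc⟩ := exists_forall_sub_eq_of_sum_formAt_d_eq_zero H hφ hsimple (f := f)
      (by rw [hf]; exact sum_formAt_starForm_eq_zero H ((hx₀ x₀).2 rfl) ((hl a).symm.trans ha)) x₀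
    refine Submodule.mem_span_singleton.2 ⟨c, funext fun y => ?_⟩
    rw [← hc y.1 fun h => y.2.ne ((hx₀ _).1 h).symm, ← formAt_d y.2, hf, formAt_starForm y.2, hext]
    simp
  have h1 : Module.finrank ℝ (LinearMap.ker τ) ≤ 1 := by
    rw [(Submodule.equivSubtypeMap _ (LinearMap.ker τ)).finrank_eq]
    exact (Submodule.finrank_mono hker).trans (by
      simpa using finrank_span_le_card (R := ℝ) ({1} : Set ({y // G.Adj x₀ y} → ℝ)))
  have h2 := LinearMap.finrank_range_add_finrank_ker τ
  have h3 := LinearMap.finrank_range_add_finrank_ker l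
  have h4 : Module.finrank ℝ (LinearMap.range l) ≤ 1 := by
    simpa using Submodule.finrank_le (LinearMap.range l)
  have h5 := Submodule.finrank_mono hτ
  rw [Module.finrank_fintype_fun_eq_card] at h3
  omega

/-- Around a zero, a harmonic function takes negative values as soon as it takes positive ones. -/
theorem exists_adj_neg_of_exists_adj_pos (hφ : H.mat *ᵥ φ = 0) (hφ₀ : φ x₀ = 0)
    (hpos : ∃ y, G.Adj x₀ y ∧ 0 < φ y) : ∃ y, G.Adj x₀ y ∧ φ y < 0 := by
  by_contra! hneg
  obtain ⟨y, hy, hφy⟩ := hpos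
  have h1 : ∑ y, H.mat x₀ y * φ y = 0 := congrFun hφ x₀
  have h2 : ∀ z ∈ Finset.univ, H.mat x₀ z * φ z ≤ 0 := by
    intro z _
    by_cases hz : G.Adj x₀ z
    · exact mul_nonpos_of_nonpos_of_nonneg (H.neg_of_adj _ _ hz).le (hneg z hz)
    · by_cases hxz : x₀ = z
      · simp [← hxz, hφ₀]
      · simp [H.zero_of_not_adj _ _ hxz hz]
  have h3 := (Finset.sum_eq_zero_iff_of_nonpos h2).1 h1 y (Finset.mem_univ y)
  exact (mul_neg_of_neg_of_pos (H.neg_of_adj _ _ hy) hφy).ne h3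

/-- No neighbour of `x₀` is a zero, so `n_+ + n_-` is the degree. If both are positive, `|n_+ - n_-|
≤ n_+ + n_- - 2`; otherwise both are zero. -/
theorem abs_ncard_sub_ncard_le [DecidableRel G.Adj] (hφ : H.mat *ᵥ φ = 0)
    (hx₀ : ∀ x, φ x = 0 ↔ x = x₀) {N : ℕ} (hN : Fintype.card {y // G.Adj x₀ y} ≤ N + 2) :
    |(({x : X | G.Adj x₀ x ∧ 0 < φ x}.ncard : ℤ) - ({x : X | G.Adj x₀ x ∧ φ x < 0}.ncard : ℤ))| ≤
      (N : ℤ) := by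
  have hφ₀ : φ x₀ = 0 := (hx₀ x₀).2 rfl
  have hcard : {x : X | G.Adj x₀ x ∧ 0 < φ x}.ncard + {x : X | G.Adj x₀ x ∧ φ x < 0}.ncard =
      Fintype.card {y // G.Adj x₀ y} := by
    rw [← Set.ncard_union_eq (Set.disjoint_left.2 fun x h h' => lt_asymm h.2 h'.2),
      ← Nat.card_eq_fintype_card]
    refine congrArg Set.ncard (Set.ext fun x => ?_)
    constructor
    · rintro (h | h) <;> exact h.1
    · intro h
      have : φ x ≠ 0 := fun h' => G.ne_of_adj h ((hx₀ x).1 h').symm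
      exact this.lt_or_gt.symm.imp (fun k => ⟨h, k⟩) (fun k => ⟨h, k⟩)
  have h1 : {x : X | G.Adj x₀ x ∧ 0 < φ x}.ncard ≠ 0 →
      {x : X | G.Adj x₀ x ∧ φ x < 0}.ncard ≠ 0 := by
    intro h
    obtain ⟨z, hz⟩ :=
      exists_adj_neg_of_exists_adj_pos H hφ hφ₀ (Set.nonempty_of_ncard_ne_zero h)
    exact Set.ncard_ne_zero_of_mem hz
  have h2 : {x : X | G.Adj x₀ x ∧ φ x < 0}.ncard ≠ 0 →
      {x : X | G.Adj x₀ x ∧ 0 < φ x}.ncard ≠ 0 := by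
    intro h
    obtain ⟨y, hy, hy'⟩ := Set.nonempty_of_ncard_ne_zero h
    obtain ⟨z, hz, hz'⟩ := exists_adj_neg_of_exists_adj_pos H (φ := -φ)
      (by rw [Matrix.mulVec_neg, hφ, neg_zero]) (by simp [hφ₀]) ⟨y, hy, by simpa using hy'⟩
    exact Set.ncard_ne_zero_of_mem (a := z) ⟨hz, by simpa using hz'⟩
  rw [abs_le]
  omega

end Star

/-! ### Descent to the quotient by gauge. -/

section Chart

variable {X : Type*} [Fintype X] {G : SimpleGraph X} [DecidableRel G.Adj]

/-- A smooth function on `1`-forms that is gauge invariant is smooth modulo gauge. -/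
theorem contDiffAt_of_comp_mkQ {f : TangentModuli G → ℝ}
    (hf : ContDiffAt ℝ ∞ (fun γ => f ((LinearMap.range (d G)).mkQ γ)) 0) : ContDiffAt ℝ ∞ f 0 := by
  -- A linear section recovers `f` from its pullback.
  obtain ⟨s, hs⟩ := (LinearMap.range (d G)).mkQ.exists_rightInverse_of_surjective
    (Submodule.range_mkQ _)
  have h : f = (fun γ => f ((LinearMap.range (d G)).mkQ γ)) ∘ s.toContinuousLinearMap := by
    funext v
    exact congrArg f (LinearMap.congr_fun hs v).symm
  rw [h]
  refine ContDiffAt.comp 0 ?_ (ContinuousLinearMap.contDiff _).contDiffAt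
  rwa [map_zero]

end Chart

end MagneticGraph
end

/-! ### The main theorem. -/

theorem mainTheorem5 {X : Type*} [Fintype X] [DecidableEq X]
    (G : SimpleGraph X) [DecidableRel G.Adj] (hG : G.Connected)
    (H : MagneticGraph.SchrodingerOperator G) (n : Fin (Fintype.card X))
    (hn : MagneticGraph.eigenvalue H n 1 = 0)
    (hsimple : Module.finrank ℝ (Module.End.eigenspace (Matrix.toLin' H.mat) 0) = 1)
    (φ : X → ℝ) (hφ : Module.End.HasEigenvector (Matrix.toLin' H.mat) 0 φ)
    (x₀ : X) (hx₀ : ∀ x : X, φ x = 0 ↔ x = x₀) :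
    ContDiffAt ℝ ∞ (MagneticGraph.eigenvalueChart H n) 0 ∧
    fderiv ℝ (MagneticGraph.eigenvalueChart H n) 0 = 0 ∧
    |(({x : X | G.Adj x₀ x ∧ 0 < φ x}.ncard : ℤ) - ({x : X | G.Adj x₀ x ∧ φ x < 0}.ncard : ℤ))| ≤
      (MagneticGraph.nullity (MagneticGraph.eigenvalueChart H n) 0 : ℤ) := by
  open MagneticGraph in
  have hHφ : H.mat *ᵥ φ = 0 := by simpa using Module.End.mem_eigenspace_iff.1 hφ.1
  have hker : ∀ y, H.mat *ᵥ y = 0 → ∃ c : ℝ, y = c • φ := fun y hy => by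
    obtain ⟨c, hc⟩ := (finrank_eq_one_iff_of_nonzero' ⟨φ, hφ.1⟩
      (fun h => hφ.2 (congrArg Subtype.val h))).1 hsimple
      ⟨y, Module.End.mem_eigenspace_iff.2 (by simpa using hy)⟩
    exact ⟨c, (congrArg Subtype.val hc).symm⟩
  set ψ : X → ℂ := fun x => (φ x : ℂ) with hψ
  let A : oneForms G → Matrix X X ℂ := fun γ => magneticMatrix H (expField G γ)
  have hA : ∀ i j, ContDiff ℝ ∞ fun γ => A γ i j := contDiff_magneticMatrix_expField H
  have hherm : ∀ γ, (A γ).IsHermitian := fun γ => magneticMatrix_isHermitian H _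
  have hA0 : A 0 = H.mat.map (fun r => (r : ℂ)) := magneticMatrix_expField_zero H
  have hψ0 : ψ ≠ 0 := fun h => hφ.2 (funext fun x => by simpa [hψ] using congrFun h x)
  have hAψ : A 0 *ᵥ ψ = 0 := by
    rw [hA0, map_ofReal_mulVec_eq_zero_iff]
    exact ⟨by simpa [hψ] using hHφ, by simp only [hψ, Complex.ofReal_im]; exact Matrix.mulVec_zero H.mat⟩
  have hAker : ∀ w, A 0 *ᵥ w = 0 → ∃ c : ℂ, w = c • ψ := fun w hw =>
    exists_eq_smul_of_map_ofReal_mulVec_eq_zero hker (by rwa [← hA0])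
  have hψψ : star ψ ⬝ᵥ ψ ≠ 0 := by
    open scoped ComplexOrder in
    exact fun h => hψ0 (dotProduct_star_self_eq_zero.1 h)
  -- The index is reversed because `eigenvalues₀` is decreasing.
  have hl0 : (hherm 0).eigenvalues₀ n.rev = 0 := by
    rw [← hn, ← expField_zero]
    rfl
  have : CompleteSpace (oneForms G) := FiniteDimensional.complete ℝ _
  obtain ⟨hl, w, hw, hw0, hwl⟩ :=
    Matrix.IsHermitian.exists_contDiffAt_eigenvector hA hherm hψ0 hAψ hAker hl0
  have hl' := Matrix.fderiv_eigenvalue_eq_zero hA hherm hψψ hAψ hl hw hw0 hwl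
    (dotProduct_magneticMatrix_expField_neg H φ)
  let π := (LinearMap.range (d G)).mkQ.toContinuousLinearMap
  have hπ : Function.Surjective π := Submodule.mkQ_surjective _
  have hsmooth : ContDiffAt ℝ ∞ (eigenvalueChart H n) 0 := contDiffAt_of_comp_mkQ hl
  have hsmooth' : ContDiffAt ℝ ∞ (eigenvalueChart H n) (π 0) := by rwa [map_zero]
  refine ⟨hsmooth, ?_, ?_⟩
  · ext v
    obtain ⟨γ, rfl⟩ := hπ v
    have h := ((hsmooth'.differentiableAt (by simp)).hasFDerivAt.comp 0 π.hasFDerivAt).fderiv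
    have h' := congrArg (fun L : oneForms G →L[ℝ] ℝ => L γ) (h.symm.trans hl')
    rw [map_zero] at h'
    exact h'
  · refine abs_ncard_sub_ncard_le H hHφ hx₀ (card_adj_le_finrank_add_two H hHφ hker hx₀ _ ?_)
    intro b hb
    have hstar := sum_formAt_starForm_eq_zero H ((hx₀ x₀).2 rfl) hb
    have hhess := Matrix.fderiv_fderiv_eigenvalue_eq_zero hA hherm hψψ hAψ hAker hl hl0 hl' hw hw0
      hwl (u := starForm G x₀ b)
      (fun x => by rw [fderiv_magneticMatrix_expField_mulVec H φ, hstar]; simp)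
      (dotProduct_magneticMatrix_expField_add_smul H φ fun x y hx hy =>
        formAt_starForm_of_ne (fun h => hx ((hx₀ x).2 h)) (fun h => hy ((hx₀ y).2 h)) b)
    refine LinearMap.mem_ker.2 (ContinuousLinearMap.ext fun v => ?_)
    obtain ⟨γ, rfl⟩ := hπ v
    -- As `π` is linear, the Hessian upstairs is the pullback of the Hessian downstairs;
    -- surjectivity of `π` lets the second argument be arbitrary.
    have h := fderiv_fderiv_comp_clm π (f := eigenvalueChart H n) (p := 0)
      (hsmooth'.of_le (show (2 : WithTop ℕ∞) ≤ ∞ from WithTop.coe_le_coe.2 le_top))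
      (starForm G x₀ b) γ
    rw [map_zero] at h
    exact h.symm.trans (congrArg (fun L : oneForms G →L[ℝ] ℝ => L γ) hhess)
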